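/- Let $n\ge 2$, let $\Omega,T\subset\mathbb R^n$ be bounded domains (nonempty, open, connected), let $\beta>0$, and let $I$ on $\Omega$ and $L$ on $T$ be nonnegative integrable functions with $\int_T L(p)\,dp=\int_\Omega I(x)\,dx$; extend $I$ by $0$ to $\mathbb R^n$. For $x,p\in\mathbb R^n$ and $c\in\mathbb R$ put $$k_{p,c}(x)=\frac{\beta^2-|x-p|^2}{2\beta}+c,\qquad h_{x,c}(p)=\frac{|x-p|^2-\beta^2}{2\beta}+c .$$ A pair $(z,w)\in C(\overline\Omega)\times C(\overline T)$ is a two-reflector of type A if $$z(x)=\sup_{p\in\overline T}k_{p,w(p)}(x)\ \ (x\in\overline\Omega),\qquad w(p)=\inf_{x\in\overline\Omega}h_{x,z(x)}(p)\ \ (p\in\overline T),$$ and of type B if these equations hold with $\sup$ and $\inf$ interchanged. Let $Q(x,p)=\langle x,p\rangle+\beta w(p)-\tfrac12|p|^2$ and, for all $x\in\mathbb R^n$, let $V^*(x)=\sup_{p\in\overline T}Q(x,p)$ (type A), respectively $V^*(x)=\inf_{p\in\overline T}Q(x,p)$ (type B). The (in general multivalued) ray-tracing map $\tilde P$ of $(z,w)$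 assigns to $x\in\mathbb R^n$ the set of all $p\in\mathbb R^n$ such that, for all $y\in\mathbb R^n$, $V^*(y)\ge V^*(x)+\langle p,y-x\rangle$ (type A), respectively $V^*(y)\le V^*(x)+\langle p,y-x\rangle$ (type B). For a set $\tau$ put $\tilde P^{-1}(\tau)=\{x\in\mathbb R^n:\tilde P(x)\cap\tau\neq\emptyset\}$. A two-reflector of type A (B) is a weak solution of type A (B) of the two-reflector problem if every $p\in\overline T$ belongs to $\tilde P(x)$ for some $x\in\overline\Omega$, and $$\int_{\tilde P^{-1}(\tau)}I(x)\,dx=\int_\tau L(p)\,dp\quad\text{for every Borel set }\tau\subseteq T .$$ **Theorem.** There exist a weak solution of type A and a weak solution of type B of the two-reflector problem. Furthermore, if $(z,w)$ and $(z',w')$ are two weak solutions of the same type with ray-tracing maps $\tilde P$ and $\tilde P'$, then $\tilde P(x)=\tilde P'(x)$ for almost every $x\in\operatorname{supp}(I)\setminus\{x: I(x)=0\}$. -/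

import Mathlib

open MeasureTheory Set

namespace TwoReflector

/-- The hyperplane `α = ℝⁿ` with its Euclidean structure. -/
abbrev Plane (n : ℕ) : Type := EuclideanSpace ℝ (Fin n)

/-- A bounded domain: nonempty, open, connected and bounded. -/
def IsBoundedDomain {n : ℕ} (Ω : Set (Plane n)) : Prop :=
  IsOpen Ω ∧ IsConnected Ω ∧ Bornology.IsBounded Ω

/-- The paraboloid `k_{p,c}(x) = (β² - |x - p|²) / (2β) + c` with focus `(p, c)`. -/
noncomputable def kParab {n : ℕ} (β : ℝ) (p : Plane n) (c : ℝ) (x : Plane n) : ℝ :=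
  (β ^ 2 - ‖x - p‖ ^ 2) / (2 * β) + c

/-- The paraboloid `h_{x,c}(p) = (|x - p|² - β²) / (2β) + c` with focus `(x, c)`. -/
noncomputable def hParab {n : ℕ} (β : ℝ) (x : Plane n) (c : ℝ) (p : Plane n) : ℝ :=
  (‖x - p‖ ^ 2 - β ^ 2) / (2 * β) + c

/-- Two-reflectors of type A: `z ∈ C(Ω̄)`, `w ∈ C(T̄)`, `z(x) = sup_{p ∈ T̄} k_{p,w(p)}(x)` on `Ω̄`
and `w(p) = inf_{x ∈ Ω̄} h_{x,z(x)}(p)` on `T̄`. Only the values of `z` on `Ω̄` and of `w` on `T̄`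
matter. -/
structure IsTwoReflectorA {n : ℕ} (β : ℝ) (Ω T : Set (Plane n)) (z w : Plane n → ℝ) : Prop where
  cont_z : ContinuousOn z (closure Ω)
  cont_w : ContinuousOn w (closure T)
  z_eq : ∀ x ∈ closure Ω, IsLUB ((fun p => kParab β p (w p) x) '' closure T) (z x)
  w_eq : ∀ p ∈ closure T, IsGLB ((fun x => hParab β x (z x) p) '' closure Ω) (w p)

/-- Two-reflectors of type B: as in type A, with supremum and infimum exchanged. -/
structure IsTwoReflectorB {n : ℕ} (β : ℝ) (Ω T : Set (Plane n)) (z w : Plane n → ℝ) : Prop where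
  cont_z : ContinuousOn z (closure Ω)
  cont_w : ContinuousOn w (closure T)
  z_eq : ∀ x ∈ closure Ω, IsGLB ((fun p => kParab β p (w p) x) '' closure T) (z x)
  w_eq : ∀ p ∈ closure T, IsLUB ((fun x => hParab β x (z x) p) '' closure Ω) (w p)

/-- `Q(x,p) = ⟨x, p⟩ + β w(p) - |p|² / 2`. -/
noncomputable def Q {n : ℕ} (β : ℝ) (w : Plane n → ℝ) (x p : Plane n) : ℝ :=
  inner ℝ x p + β * w p - ‖p‖ ^ 2 / 2

/-- The convex potential on the whole plane of a two-reflector of type A: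
`V*(x) = sup_{p ∈ T̄} Q(x,p)`. -/
noncomputable def potentialA {n : ℕ} (β : ℝ) (T : Set (Plane n)) (w : Plane n → ℝ)
    (x : Plane n) : ℝ :=
  sSup (Q β w x '' closure T)

/-- The concave potential on the whole plane of a two-reflector of type B:
`V*(x) = inf_{p ∈ T̄} Q(x,p)`. -/
noncomputable def potentialB {n : ℕ} (β : ℝ) (T : Set (Plane n)) (w : Plane n → ℝ)
    (x : Plane n) : ℝ :=
  sInf (Q β w x '' closure T)

/-- The normal map of `u` at `x₀`: all `p` such that the hyperplane
`Z - u(x₀) = ⟨p, x - x₀⟩` supports the graph of `u` from below at `(x₀, u(x₀))`. -/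
def normalMap {n : ℕ} (u : Plane n → ℝ) (x₀ : Plane n) : Set (Plane n) :=
  {p | ∀ x, u x₀ + inner ℝ p (x - x₀) ≤ u x}

/-- The (multivalued) ray tracing map of a two-reflector of type A. -/
def rayMapA {n : ℕ} (β : ℝ) (T : Set (Plane n)) (w : Plane n → ℝ) (x : Plane n) :
    Set (Plane n) :=
  normalMap (potentialA β T w) x

/-- The (multivalued) ray tracing map of a two-reflector of type B: the slopes of the hyperplanes
that support the graph of the concave potential from above. -/
def rayMapB {n : ℕ} (β : ℝ) (T : Set (Plane n)) (w : Plane n → ℝ) (x : Plane n) :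
    Set (Plane n) :=
  {p | -p ∈ normalMap (fun y => -potentialB β T w y) x}

/-- The preimage `P⁻¹(τ)` of `τ` under a multivalued map: all `x` with `P(x) ∩ τ ≠ ∅`. -/
def rayPreimage {n : ℕ} (P : Plane n → Set (Plane n)) (τ : Set (Plane n)) : Set (Plane n) :=
  {x | ∃ p ∈ τ, p ∈ P x}

/-- The transported energy `λ(τ) = ∫_{P⁻¹(τ)} I(x) dx`, with `I` extended by `0` outside `Ω`. -/
noncomputable def transported {n : ℕ} (Ω : Set (Plane n)) (I : Plane n → ℝ)
    (P : Plane n → Set (Plane n)) (τ : Set (Plane n)) : ℝ :=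
  ∫ x in rayPreimage P τ, Ω.indicator I x

/-- The multivalued map `P` covers `T̄` from `Ω̄`, and carries the intensity `I` on `Ω` to the
intensity `L` on `T`. -/
structure Transports {n : ℕ} (Ω T : Set (Plane n)) (I L : Plane n → ℝ)
    (P : Plane n → Set (Plane n)) : Prop where
  onto : ∀ p ∈ closure T, ∃ x ∈ closure Ω, p ∈ P x
  energy : ∀ τ : Set (Plane n), MeasurableSet τ → τ ⊆ T →
    transported Ω I P τ = ∫ p in τ, L p

/-- Weak solutions of type A of the two-reflector problem. -/
def IsWeakSolutionA {n : ℕ} (β : ℝ) (Ω T : Set (Plane n)) (I L : Plane n → ℝ)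
    (z w : Plane n → ℝ) : Prop :=
  IsTwoReflectorA β Ω T z w ∧ Transports Ω T I L (rayMapA β T w)

/-- Weak solutions of type B of the two-reflector problem. -/
def IsWeakSolutionB {n : ℕ} (β : ℝ) (Ω T : Set (Plane n)) (I L : Plane n → ℝ)
    (z w : Plane n → ℝ) : Prop :=
  IsTwoReflectorB β Ω T z w ∧ Transports Ω T I L (rayMapB β T w)

/-- `supp(I) \ {I = 0}`, with `I` extended by `0` outside `Ω`. -/
def activeSet {n : ℕ} (Ω : Set (Plane n)) (I : Plane n → ℝ) : Set (Plane n) :=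
  tsupport (Ω.indicator I) \ {x | Ω.indicator I x = 0}

end TwoReflector

/-!
The two-reflector problem is optimal transport with quadratic cost. Completing squares, with
`f p = |p|² / 2 - β w p`, the potential of a reflector of type A is the conjugate
`conj (closure T) f`, and the reflector equations say that `f` equals its biconjugate, the outer
conjugate being taken over `closure Ω`. In type B the same holds for minus the potential, after
`T` is reflected to `-T`; so both types reduce to one statement about conjugates.

Conjugates relative to a bounded set are Lipschitz, hence differentiable almost everywhere, and
there the normal map is the singleton of the gradient, which is also the only point where the
supremum is attained (`ae_conj_maximizer`). Consequently the energy balance says that the gradient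
pushes the measure with density `I` forward to the one with density `L` (`energy_iff_map_eq`).

Existence: the dual functional `∫ f* I + ∫ f L` has a minimiser among continuous functions, by the
Arzelà–Ascoli theorem, because taking the biconjugate and subtracting a constant leads to uniformly
Lipschitz functions without increasing the functional (`exists_isMinOn_dualFunctional`). By the
envelope theorem (`tendsto_conj_variation`) its Euler–Lagrange equation is the transport condition
(`map_gradient_eq_of_isMin`). That every `p` in `closure T` is attained follows from `f` being its
own biconjugate.

Uniqueness: if `∇f*` transports, then `f` minimises the dual functional, by integrating Young's
inequality along the map. Two such functions have equal functionals, so Young's inequality for one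
is an equality along the gradient map of the other, and uniqueness of the maximizer identifies the
two maps (`ae_gradient_conj_eq`).
-/

namespace TwoReflector

open Filter Topology

/-! ### Conjugates relative to a compact set -/

section Conjugate

theorem exists_norm_le_of_isCompact {E : Type*} [NormedAddCommGroup E] {S : Set E}
    (hS : IsCompact S) : ∃ R : NNReal, ∀ p ∈ S, ‖p‖ ≤ R := by
  obtain ⟨R, hR⟩ := hS.isBounded.exists_norm_le
  exact ⟨R.toNNReal, fun p hp => (hR p hp).trans (Real.le_coe_toNNReal R)⟩

variable {E : Type*} [NormedAddCommGroup E] [InnerProductSpace ℝ E]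

/-- The Legendre conjugate relative to a set: `conj S f x = sup_{p ∈ S} (⟨x, p⟩ - f p)`, defined for
every `x`. Only the values of `f` on `S` matter. -/
noncomputable def conj (S : Set E) (f : E → ℝ) (x : E) : ℝ :=
  sSup ((fun p => inner ℝ x p - f p) '' S)

variable {K S : Set E} {f g : E → ℝ}

theorem exists_conj_eq (hS : IsCompact S) (hne : S.Nonempty) (hf : ContinuousOn f S) (x : E) :
    ∃ p ∈ S, conj S f x = inner ℝ x p - f p ∧
      ∀ q ∈ S, inner ℝ x q - f q ≤ inner ℝ x p - f p := by
  obtain ⟨p, hp, hmax⟩ := hS.exists_isMaxOn hne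
    (f := fun p => inner ℝ x p - f p) (by fun_prop)
  refine ⟨p, hp, ?_, fun q hq => hmax hq⟩
  exact IsGreatest.csSup_eq ⟨mem_image_of_mem _ hp, by rintro _ ⟨q, hq, rfl⟩; exact hmax hq⟩

theorem le_conj (hS : IsCompact S) (hf : ContinuousOn f S) (x : E) {p : E} (hp : p ∈ S) :
    inner ℝ x p - f p ≤ conj S f x := by
  obtain ⟨q, -, h, hmax⟩ := exists_conj_eq hS ⟨p, hp⟩ hf x
  rw [h]
  exact hmax p hp

theorem isLUB_conj (hS : IsCompact S) (hne : S.Nonempty) (hf : ContinuousOn f S) (x : E) :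
    IsLUB ((fun p => inner ℝ x p - f p) '' S) (conj S f x) := by
  refine isLUB_csSup (hne.image _) ⟨conj S f x, ?_⟩
  rintro _ ⟨q, hq, rfl⟩
  exact le_conj hS hf x hq

theorem conj_congr (h : ∀ p ∈ S, f p = g p) : conj S f = conj S g := by
  funext x
  unfold conj
  congr 1
  exact image_congr fun p hp => by rw [h p hp]

theorem conj_le_add (hS : IsCompact S) (hne : S.Nonempty) (hf : ContinuousOn f S)
    (hg : ContinuousOn g S) {c : ℝ} (h : ∀ p ∈ S, g p ≤ f p + c) (x : E) :
    conj S f x ≤ conj S g x + c := by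
  obtain ⟨p, hp, he, -⟩ := exists_conj_eq hS hne hf x
  have := le_conj hS hg x hp
  have := h p hp
  linarith

theorem conj_sub_const (hS : IsCompact S) (hne : S.Nonempty) (hf : ContinuousOn f S) (c : ℝ)
    (x : E) : conj S (fun p => f p - c) x = conj S f x + c := by
  have hf' : ContinuousOn (fun p => f p - c) S := by fun_prop
  apply le_antisymm
  · exact conj_le_add hS hne hf' hf (fun p _ => by linarith) x
  · have := conj_le_add (c := -c) hS hne hf hf' (fun p _ => by linarith) x
    linarith

theorem lipschitzWith_conj (hS : IsCompact S) (hne : S.Nonempty) (hf : ContinuousOn f S)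
    {R : NNReal} (hR : ∀ p ∈ S, ‖p‖ ≤ R) : LipschitzWith R (conj S f) := by
  refine LipschitzWith.of_le_add_mul R fun x y => ?_
  obtain ⟨p, hp, he, -⟩ := exists_conj_eq hS hne hf x
  have h1 := le_conj hS hf y hp
  have h2 : inner ℝ x p - inner ℝ y p ≤ R * dist x y := by
    rw [← inner_sub_left, dist_eq_norm, mul_comm]
    exact (real_inner_le_norm _ _).trans (by gcongr; exact hR p hp)
  linarith

theorem continuous_conj (hS : IsCompact S) (hne : S.Nonempty) (hf : ContinuousOn f S) :
    Continuous (conj S f) := by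
  obtain ⟨R, hR⟩ := exists_norm_le_of_isCompact hS
  exact (lipschitzWith_conj hS hne hf hR).continuous

theorem conj_conj_le (hK : IsCompact K) (hKne : K.Nonempty) (hS : IsCompact S)
    (hf : ContinuousOn f S) {p : E} (hp : p ∈ S) : conj K (conj S f) p ≤ f p := by
  obtain ⟨x, hx, he, -⟩ := exists_conj_eq hK hKne
    (continuous_conj hS ⟨p, hp⟩ hf).continuousOn p
  have := le_conj hS hf x hp
  rw [real_inner_comm] at this
  linarith

theorem conj_conj_conj (hK : IsCompact K) (hS : IsCompact S) (hne : S.Nonempty)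
    (hf : ContinuousOn f S) {x : E} (hx : x ∈ K) :
    conj S (conj K (conj S f)) x = conj S f x := by
  have hc := (continuous_conj hS hne hf).continuousOn (s := K)
  have hcc := (continuous_conj hK ⟨x, hx⟩ hc).continuousOn (s := S)
  apply le_antisymm
  · exact conj_conj_le hS hne hK hc hx
  · have := conj_le_add (c := 0) hS hne hf hcc
      (fun p hp => by rw [add_zero]; exact conj_conj_le hK ⟨x, hx⟩ hS hf hp) x
    linarith

/-- A point where the supremum defining the conjugate is attained is a subgradient. -/
theorem conj_add_inner_le (hS : IsCompact S) (hf : ContinuousOn f S) {x p : E} (hp : p ∈ S)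
    (h : conj S f x = inner ℝ x p - f p) (y : E) :
    conj S f x + inner ℝ p (y - x) ≤ conj S f y := by
  have := le_conj hS hf y hp
  rw [h, inner_sub_right, real_inner_comm y p, real_inner_comm x p]
  linarith

/-- At a point of differentiability the gradient is the only subgradient. -/
theorem eq_gradient_of_forall_add_inner_le [CompleteSpace E] {u : E → ℝ} {x p : E}
    (hu : DifferentiableAt ℝ u x) (h : ∀ y, u x + inner ℝ p (y - x) ≤ u y) :
    p = gradient u x := by
  have hmin : IsLocalMin (fun y => u y - (InnerProductSpace.toDual ℝ E p) y) x :=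
    Eventually.of_forall fun y => by
      have := h y
      simp only [InnerProductSpace.toDual_apply_apply]
      rw [inner_sub_right] at this
      linarith
  have hd := hmin.hasFDerivAt_eq_zero
    (hu.hasFDerivAt.sub (InnerProductSpace.toDual ℝ E p).hasFDerivAt)
  rw [gradient, sub_eq_zero.1 hd]
  simp

variable [FiniteDimensional ℝ E] [MeasurableSpace E] [BorelSpace E]

theorem measurable_gradient (u : E → ℝ) : Measurable (gradient u) :=
  (InnerProductSpace.toDual ℝ E).symm.continuous.measurable.comp (measurable_fderiv ℝ u)

/-- By Rademacher's theorem the supremum defining the conjugate is, at almost every point, attained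
exactly at the gradient. -/
theorem ae_conj_maximizer (m : Measure E) [m.IsAddHaarMeasure] (hS : IsCompact S)
    (hne : S.Nonempty) (hf : ContinuousOn f S) :
    ∀ᵐ x ∂m, DifferentiableAt ℝ (conj S f) x ∧ gradient (conj S f) x ∈ S ∧
      conj S f x = inner ℝ x (gradient (conj S f) x) - f (gradient (conj S f) x) ∧
      ∀ p ∈ S, conj S f x = inner ℝ x p - f p → p = gradient (conj S f) x := by
  obtain ⟨R, hR⟩ := exists_norm_le_of_isCompact hS
  filter_upwards [(lipschitzWith_conj hS hne hf hR).ae_differentiableAt (μ := m)] with x hx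
  have key : ∀ p ∈ S, conj S f x = inner ℝ x p - f p → p = gradient (conj S f) x :=
    fun p hp h => eq_gradient_of_forall_add_inner_le hx (conj_add_inner_le hS hf hp h)
  obtain ⟨p, hp, he, -⟩ := exists_conj_eq hS hne hf x
  have := key p hp he
  subst this
  exact ⟨hx, hp, he, key⟩

end Conjugate

/-! ### The envelope theorem for conjugates -/

section Variation

variable {E : Type*} [NormedAddCommGroup E] [InnerProductSpace ℝ E] {S : Set E} {f g : E → ℝ}

theorem abs_conj_sub_conj_le (hS : IsCompact S) (hne : S.Nonempty) (hf : ContinuousOn f S)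
    (hg : ContinuousOn g S) {c : ℝ} (h : ∀ p ∈ S, |f p - g p| ≤ c) (x : E) :
    |conj S f x - conj S g x| ≤ c := by
  rw [abs_le]
  have h1 := conj_le_add (c := c) hS hne hf hg
    (fun p hp => by have := (abs_le.1 (h p hp)).1; linarith) x
  have h2 := conj_le_add (c := c) hS hne hg hf
    (fun p hp => by have := (abs_le.1 (h p hp)).2; linarith) x
  constructor <;> linarith

/-- The envelope theorem: if the supremum in `conj S f x` is attained only at `p`, then the
one-sided derivative of `t ↦ conj S (f + t g) x` at `0` is `-g p`. -/
theorem tendsto_conj_variation (hS : IsCompact S) (hf : ContinuousOn f S) (hg : ContinuousOn g S)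
    {x p : E} (hp : p ∈ S) (he : conj S f x = inner ℝ x p - f p)
    (huniq : ∀ q ∈ S, conj S f x = inner ℝ x q - f q → q = p) :
    Tendsto (fun t : ℝ => (conj S (fun q => f q + t * g q) x - conj S f x) / t) (𝓝[>] 0)
      (𝓝 (-g p)) := by
  have hne : S.Nonempty := ⟨p, hp⟩
  have hc : ∀ t : ℝ, ContinuousOn (fun q => f q + t * g q) S := fun t => by fun_prop
  have hlow : ∀ t : ℝ, conj S f x - t * g p ≤ conj S (fun q => f q + t * g q) x := fun t => by
    have := le_conj hS (hc t) x hp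
    linarith
  refine tendsto_order.2 ⟨fun a ha => ?_, fun a ha => ?_⟩
  · filter_upwards [self_mem_nhdsWithin] with t ht
    refine ha.trans_le ?_
    rw [le_div_iff₀ ht]
    linarith [hlow t]
  · -- Maximizers for small `t` avoid the compact set `B`, on which the unperturbed function stays
    -- below its maximum by a positive gap.
    set B := S ∩ g ⁻¹' Iic (-a) with hB
    have hBc : IsCompact B := hS.of_isClosed_subset
      (hg.preimage_isClosed_of_isClosed hS.isClosed isClosed_Iic) inter_subset_left
    have hpB : p ∉ B := fun h => by have : g p ≤ -a := h.2; linarith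
    obtain ⟨C, hC⟩ := hS.exists_bound_of_continuousOn hg
    obtain ⟨δ, hδ, hgap⟩ : ∃ δ > 0, ∀ q ∈ B, inner ℝ x q - f q ≤ conj S f x - δ := by
      rcases B.eq_empty_or_nonempty with hemp | hBne
      · exact ⟨1, one_pos, by simp [hemp]⟩
      · obtain ⟨q, hq, hmax⟩ := hBc.exists_isMaxOn hBne
          (f := fun p => inner ℝ x p - f p) (by have := hf.mono (inter_subset_left : B ⊆ S); fun_prop)
        refine ⟨conj S f x - (inner ℝ x q - f q), ?_, fun r hr => ?_⟩
        · refine sub_pos.2 (lt_of_le_of_ne (le_conj hS hf x hq.1) fun h => hpB ?_)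
          rw [← huniq q hq.1 h.symm]
          exact hq
        · have : inner ℝ x r - f r ≤ inner ℝ x q - f q := hmax hr
          linarith
    have hsmall : ∀ᶠ t : ℝ in 𝓝[>] 0, t * (C + g p) < δ := by
      have : Tendsto (fun t : ℝ => t * (C + g p)) (𝓝[>] 0) (𝓝 (0 * (C + g p))) :=
        ((continuous_id.mul continuous_const).tendsto 0).mono_left nhdsWithin_le_nhds
      rw [zero_mul] at this
      exact this.eventually_lt_const hδ
    filter_upwards [self_mem_nhdsWithin, hsmall] with t (ht : 0 < t) hts
    obtain ⟨q, hq, hqe, -⟩ := exists_conj_eq hS hne (hc t) x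
    have hqB : q ∉ B := fun h => by
      have h1 := hgap q h
      have h2 := hlow t
      have h3 : t * (-C) ≤ t * g q :=
        mul_le_mul_of_nonneg_left (neg_le_of_abs_le (hC q hq)) ht.le
      linarith
    have hga : -a < g q := by
      by_contra h
      exact hqB ⟨hq, not_lt.1 h⟩
    rw [div_lt_iff₀ ht]
    have h1 := le_conj hS hf x hq
    have h2 := mul_lt_mul_of_pos_left hga ht
    linarith

end Variation

/-! ### The dual functional: minimisers transport, and transport maps are unique -/

section Duality

variable {E : Type*} [NormedAddCommGroup E] [InnerProductSpace ℝ E] [FiniteDimensional ℝ E]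
  [MeasurableSpace E] [BorelSpace E] {K S : Set E} {f g : E → ℝ} {μ ν : Measure E}

/-- Kantorovich's dual functional `∫ f* dμ + ∫ f dν` for the cost `-⟨x, p⟩`, where `f*` is the
conjugate of `f` relative to `S`. -/
noncomputable def dualFunctional (μ ν : Measure E) (S : Set E) (f : E → ℝ) : ℝ :=
  ∫ x, conj S f x ∂μ + ∫ p, f p ∂ν

theorem integrable_of_continuousOn_isCompact [IsFiniteMeasure μ] (hK : IsCompact K)
    (hμ : ∀ᵐ x ∂μ, x ∈ K) (hf : ContinuousOn f K) : Integrable f μ := by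
  have := hf.integrableOn_compact (μ := μ) hK
  rwa [IntegrableOn, Measure.restrict_eq_self_of_ae_mem hμ] at this

theorem integrable_conj [IsFiniteMeasure μ] (hK : IsCompact K) (hμ : ∀ᵐ x ∂μ, x ∈ K)
    (hS : IsCompact S) (hne : S.Nonempty) (hf : ContinuousOn f S) : Integrable (conj S f) μ :=
  integrable_of_continuousOn_isCompact hK hμ (continuous_conj hS hne hf).continuousOn

theorem dualFunctional_sub_const [IsFiniteMeasure μ] [IsFiniteMeasure ν] (hK : IsCompact K)
    (hμ : ∀ᵐ x ∂μ, x ∈ K) (hS : IsCompact S) (hne : S.Nonempty) (hν : ∀ᵐ p ∂ν, p ∈ S)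
    (hM : μ univ = ν univ) (hf : ContinuousOn f S) (c : ℝ) :
    dualFunctional μ ν S (fun p => f p - c) = dualFunctional μ ν S f := by
  have hM' : μ.real univ = ν.real univ := by simp [Measure.real, hM]
  simp only [dualFunctional, conj_sub_const hS hne hf]
  rw [integral_add (integrable_conj hK hμ hS hne hf) (integrable_const c),
    integral_sub (integrable_of_continuousOn_isCompact hS hν hf) (integrable_const c)]
  simp only [integral_const, hM']
  ring

theorem dualFunctional_conj_conj_le [IsFiniteMeasure μ] [IsFiniteMeasure ν] (hK : IsCompact K)
    (hKne : K.Nonempty) (hμ : ∀ᵐ x ∂μ, x ∈ K) (hS : IsCompact S) (hne : S.Nonempty)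
    (hν : ∀ᵐ p ∂ν, p ∈ S) (hf : ContinuousOn f S) :
    dualFunctional μ ν S (conj K (conj S f)) ≤ dualFunctional μ ν S f := by
  have hcc := continuous_conj hK hKne (continuous_conj hS hne hf).continuousOn
  refine add_le_add (le_of_eq (integral_congr_ae ?_)) (integral_mono_ae
    (integrable_of_continuousOn_isCompact hS hν hcc.continuousOn)
    (integrable_of_continuousOn_isCompact hS hν hf) ?_)
  · filter_upwards [hμ] with x hx using conj_conj_conj hK hS hne hf hx
  · filter_upwards [hν] with p hp using conj_conj_le hK hKne hS hf hp

theorem abs_dualFunctional_sub_le [IsFiniteMeasure μ] [IsFiniteMeasure ν] (hK : IsCompact K)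
    (hμ : ∀ᵐ x ∂μ, x ∈ K) (hS : IsCompact S) (hne : S.Nonempty) (hν : ∀ᵐ p ∂ν, p ∈ S)
    (hf : ContinuousOn f S) (hg : ContinuousOn g S) {c : ℝ} (h : ∀ p ∈ S, |f p - g p| ≤ c) :
    |dualFunctional μ ν S f - dualFunctional μ ν S g| ≤ c * (μ.real univ + ν.real univ) := by
  have h1 : |∫ x, (conj S f x - conj S g x) ∂μ| ≤ c * μ.real univ := by
    rw [← Real.norm_eq_abs]
    refine norm_integral_le_of_norm_le_const (Eventually.of_forall fun x => ?_)
    exact abs_conj_sub_conj_le hS hne hf hg h x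
  have h2 : |∫ p, (f p - g p) ∂ν| ≤ c * ν.real univ := by
    rw [← Real.norm_eq_abs]
    refine norm_integral_le_of_norm_le_const ?_
    filter_upwards [hν] with p hp using h p hp
  rw [integral_sub (integrable_conj hK hμ hS hne hf) (integrable_conj hK hμ hS hne hg)] at h1
  rw [integral_sub (integrable_of_continuousOn_isCompact hS hν hf)
    (integrable_of_continuousOn_isCompact hS hν hg)] at h2
  have h3 := abs_add_le (∫ x, conj S f x ∂μ - ∫ x, conj S g x ∂μ) (∫ p, f p ∂ν - ∫ p, g p ∂ν)
  calc |dualFunctional μ ν S f - dualFunctional μ ν S g|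
      = |(∫ x, conj S f x ∂μ - ∫ x, conj S g x ∂μ) + (∫ p, f p ∂ν - ∫ p, g p ∂ν)| := by
        unfold dualFunctional
        congr 1
        ring
    _ ≤ c * (μ.real univ + ν.real univ) := by linarith

/-- The Arzelà–Ascoli theorem for Lipschitz functions normalised at a point. -/
theorem isCompact_setOf_lipschitzWith {X : Type*} [PseudoMetricSpace X] [CompactSpace X]
    (R : NNReal) (p₀ : X) : IsCompact {h : C(X, ℝ) | LipschitzWith R h ∧ h p₀ = 0} := by
  refine ArzelaAscoli.isCompact_of_equicontinuous _ ?_ ?_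
  · have himg : ContinuousMap.toFun '' {h : C(X, ℝ) | LipschitzWith R h ∧ h p₀ = 0} =
        {h : X → ℝ | LipschitzWith R h ∧ h p₀ = 0} := by
      ext h
      constructor
      · rintro ⟨h, hh, rfl⟩
        exact hh
      · exact fun hh => ⟨⟨h, hh.1.continuous⟩, hh, rfl⟩
    rw [himg]
    refine (isCompact_univ_pi fun p : X =>
      (isCompact_Icc (a := -(R * dist p p₀)) (b := R * dist p p₀))).of_isClosed_subset ?_ ?_
    · simp only [lipschitzWith_iff_dist_le_mul, Set.ofPred_and, Set.ofPred_forall]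
      refine (isClosed_iInter fun x => isClosed_iInter fun y => ?_).inter ?_
      · exact isClosed_le (by fun_prop) continuous_const
      · exact isClosed_eq (by fun_prop) continuous_const
    · intro h hh p _
      have := hh.1.dist_le_mul p p₀
      rw [hh.2, Real.dist_eq, sub_zero] at this
      exact abs_le.1 this
  · exact (LipschitzWith.uniformEquicontinuous _ R fun h => h.2.1).equicontinuous

/-- The dual functional attains its minimum, and does so at a function that equals its biconjugate:
passing to the biconjugate and subtracting a constant does not increase the functional and leads to
the compact class of normalised Lipschitz functions. -/
theorem exists_isMinOn_dualFunctional [IsFiniteMeasure μ] [IsFiniteMeasure ν] (hK : IsCompact K)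
    (hKne : K.Nonempty) (hμ : ∀ᵐ x ∂μ, x ∈ K) (hS : IsCompact S) (hne : S.Nonempty)
    (hν : ∀ᵐ p ∂ν, p ∈ S) (hM : μ univ = ν univ) :
    ∃ f : E → ℝ, Continuous f ∧ (∀ p ∈ S, f p = conj K (conj S f) p) ∧
      ∀ g, ContinuousOn g S → dualFunctional μ ν S f ≤ dualFunctional μ ν S g := by
  classical
  obtain ⟨R, hR⟩ := exists_norm_le_of_isCompact hK
  obtain ⟨p₀, hp₀⟩ := hne
  have hne : S.Nonempty := ⟨p₀, hp₀⟩
  have : CompactSpace S := isCompact_iff_compactSpace.1 hS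
  -- Elements of `C(S, ℝ)` are extended by `0` to functions on the whole space.
  let ext (h : C(S, ℝ)) (p : E) : ℝ := if hp : p ∈ S then h ⟨p, hp⟩ else 0
  have hext : ∀ (h : C(S, ℝ)) (p : S), ext h p = h p := fun h p => by simp [ext, p.2]
  have hextc : ∀ h, ContinuousOn (ext h) S := fun h => by
    rw [continuousOn_iff_continuous_domRestrict]
    have : S.domRestrict (ext h) = h := funext fun p => hext h p
    rw [this]
    exact h.continuous
  have hJc : Continuous fun h => dualFunctional μ ν S (ext h) := by
    have hL : LipschitzWith (μ.real univ + ν.real univ).toNNReal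
        fun h => dualFunctional μ ν S (ext h) := by
      refine LipschitzWith.of_dist_le_mul fun h k => ?_
      rw [Real.coe_toNNReal _ (by positivity), mul_comm, Real.dist_eq]
      refine abs_dualFunctional_sub_le hK hμ hS hne hν (hextc h) (hextc k) fun p hp => ?_
      rw [hext h ⟨p, hp⟩, hext k ⟨p, hp⟩]
      rw [← Real.dist_eq]
      exact ContinuousMap.dist_apply_le_dist _
    exact hL.continuous
  obtain ⟨h, -, hmin⟩ := (isCompact_setOf_lipschitzWith R (⟨p₀, hp₀⟩ : S)).exists_isMinOn
    ⟨0, LipschitzWith.const' 0, rfl⟩ hJc.continuousOn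
  have hall : ∀ g, ContinuousOn g S →
      dualFunctional μ ν S (ext h) ≤ dualFunctional μ ν S g := fun g hg => by
    have hgc := (continuous_conj hS hne hg).continuousOn (s := K)
    have hl := lipschitzWith_conj hK hKne hgc hR
    set G := conj K (conj S g)
    have hl' : LipschitzWith R fun p : S => G p - G p₀ := by
      refine LipschitzWith.of_dist_le_mul fun p q => ?_
      rw [dist_sub_right]
      exact hl.dist_le_mul p q
    have h1 := hmin (a := ⟨fun p : S => G p - G p₀, hl'.continuous⟩) ⟨hl', by simp⟩
    refine le_trans h1 (le_trans (le_of_eq ?_)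
      (dualFunctional_conj_conj_le hK hKne hμ hS hne hν hg))
    rw [← dualFunctional_sub_const hK hμ hS hne hν hM hl.continuous.continuousOn (G p₀)]
    have hS' : ∀ p ∈ S, ext ⟨fun p : S => G p - G p₀, hl'.continuous⟩ p = G p - G p₀ :=
      fun p hp => hext _ ⟨p, hp⟩
    simp only [dualFunctional]
    rw [conj_congr hS']
    congr 1
    refine integral_congr_ae ?_
    filter_upwards [hν] with p hp using hS' p hp
  have hcS := continuous_conj hS hne (hextc h)
  have hcc := continuous_conj hK hKne (hcS.continuousOn (s := K))
  refine ⟨conj K (conj S (ext h)), hcc, fun p _ => ?_, fun g hg =>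
    (dualFunctional_conj_conj_le hK hKne hμ hS hne hν (hextc h)).trans (hall g hg)⟩
  rw [conj_congr (S := K) fun x hx => conj_conj_conj hK hS hne (hextc h) hx]

/-- The first variation of the dual functional at a minimiser: the difference quotients in the
direction `g` are bounded by `sup |g|` and converge by the envelope theorem. Applied to `-g` it gives
the reverse inequality. -/
theorem integral_comp_gradient_le_of_isMin [IsFiniteMeasure μ] [IsFiniteMeasure ν] (m : Measure E)
    [m.IsAddHaarMeasure] (hac : μ ≪ m) (hK : IsCompact K) (hμ : ∀ᵐ x ∂μ, x ∈ K)
    (hS : IsCompact S) (hne : S.Nonempty) (hν : ∀ᵐ p ∂ν, p ∈ S) (hf : ContinuousOn f S)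
    (hmin : ∀ g, ContinuousOn g S → dualFunctional μ ν S f ≤ dualFunctional μ ν S g)
    (hg : Continuous g) :
    ∫ x, g (gradient (conj S f) x) ∂μ ≤ ∫ p, g p ∂ν := by
  obtain ⟨C, hC⟩ := hS.exists_bound_of_continuousOn hg.continuousOn
  have hc : ∀ t : ℝ, ContinuousOn (fun q => f q + t * g q) S := fun t => by fun_prop
  have hlim : Tendsto (fun t : ℝ => ∫ x, (conj S (fun q => f q + t * g q) x - conj S f x) / t ∂μ)
      (𝓝[>] 0) (𝓝 (∫ x, -g (gradient (conj S f) x) ∂μ)) := by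
    refine tendsto_integral_filter_of_dominated_convergence (fun _ => C)
      (Eventually.of_forall fun t => ?_) ?_ (integrable_const C) ?_
    · exact (((continuous_conj hS hne (hc t)).sub (continuous_conj hS hne hf)).div_const
        t).aestronglyMeasurable
    · filter_upwards [self_mem_nhdsWithin] with t (ht : 0 < t)
      refine Eventually.of_forall fun x => ?_
      rw [Real.norm_eq_abs, abs_div, abs_of_pos ht, div_le_iff₀ ht]
      refine abs_conj_sub_conj_le hS hne (hc t) hf (fun p hp => ?_) x
      rw [add_sub_cancel_left, abs_mul, abs_of_pos ht, mul_comm]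
      exact mul_le_mul_of_nonneg_right (hC p hp) ht.le
    · filter_upwards [hac.ae_le (ae_conj_maximizer m hS hne hf)] with x hx
      exact tendsto_conj_variation hS hf hg.continuousOn hx.2.1 hx.2.2.1 hx.2.2.2
  have hge : ∀ᶠ t : ℝ in 𝓝[>] 0,
      -∫ p, g p ∂ν ≤ ∫ x, (conj S (fun q => f q + t * g q) x - conj S f x) / t ∂μ := by
    filter_upwards [self_mem_nhdsWithin] with t (ht : 0 < t)
    have h1 := hmin _ (hc t)
    unfold dualFunctional at h1
    rw [integral_add (integrable_of_continuousOn_isCompact hS hν hf)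
      ((integrable_of_continuousOn_isCompact hS hν hg.continuousOn).const_mul t),
      integral_const_mul] at h1
    rw [integral_div, integral_sub (integrable_conj hK hμ hS hne (hc t))
      (integrable_conj hK hμ hS hne hf), le_div_iff₀ ht]
    linarith
  have := ge_of_tendsto hlim hge
  rw [integral_neg] at this
  linarith

/-- The Euler–Lagrange equation of the dual functional: the gradient of the conjugate of a
minimiser transports `μ` to `ν`. -/
theorem map_gradient_eq_of_isMin [IsFiniteMeasure μ] [IsFiniteMeasure ν] (m : Measure E)
    [m.IsAddHaarMeasure] (hac : μ ≪ m) (hK : IsCompact K) (hμ : ∀ᵐ x ∂μ, x ∈ K)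
    (hS : IsCompact S) (hne : S.Nonempty) (hν : ∀ᵐ p ∂ν, p ∈ S) (hf : ContinuousOn f S)
    (hmin : ∀ g, ContinuousOn g S → dualFunctional μ ν S f ≤ dualFunctional μ ν S g) :
    μ.map (gradient (conj S f)) = ν := by
  refine ext_of_forall_integral_eq_of_IsFiniteMeasure fun g => ?_
  rw [integral_map (measurable_gradient _).aemeasurable g.continuous.aestronglyMeasurable]
  refine le_antisymm
    (integral_comp_gradient_le_of_isMin m hac hK hμ hS hne hν hf hmin g.continuous) ?_
  have := integral_comp_gradient_le_of_isMin m hac hK hμ hS hne hν hf hmin g.continuous.neg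
  simp only [Pi.neg_apply, integral_neg] at this
  linarith

/-- If `∇f*` transports `μ` to `ν`, the dual functional of any `g` becomes an integral over `μ`
alone. -/
theorem dualFunctional_eq_integral [IsFiniteMeasure μ] [IsFiniteMeasure ν] (hK : IsCompact K)
    (hμ : ∀ᵐ x ∂μ, x ∈ K) (hS : IsCompact S) (hne : S.Nonempty) (hν : ∀ᵐ p ∂ν, p ∈ S)
    (hg : ContinuousOn g S) (hmap : μ.map (gradient (conj S f)) = ν) :
    Integrable (fun x => conj S g x + g (gradient (conj S f) x)) μ ∧
      dualFunctional μ ν S g = ∫ x, (conj S g x + g (gradient (conj S f) x)) ∂μ := by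
  have hgi : Integrable g (μ.map (gradient (conj S f))) := by
    rw [hmap]
    exact integrable_of_continuousOn_isCompact hS hν hg
  have hcomp : Integrable (fun x => g (gradient (conj S f) x)) μ :=
    hgi.comp_measurable (measurable_gradient (conj S f))
  refine ⟨(integrable_conj hK hμ hS hne hg).add hcomp, ?_⟩
  rw [integral_add (integrable_conj hK hμ hS hne hg) hcomp, dualFunctional, ← hmap,
    integral_map (measurable_gradient _).aemeasurable hgi.aestronglyMeasurable]

/-- At almost every point, Young's inequality for `g` at `∇f*(x)` compares with the equality that
holds there for `f`. -/
theorem ae_conj_add_le [IsFiniteMeasure μ] (m : Measure E) [m.IsAddHaarMeasure] (hac : μ ≪ m)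
    (hS : IsCompact S) (hne : S.Nonempty) (hf : ContinuousOn f S) (hg : ContinuousOn g S) :
    ∀ᵐ x ∂μ, conj S f x + f (gradient (conj S f) x) ≤
      conj S g x + g (gradient (conj S f) x) := by
  filter_upwards [hac.ae_le (ae_conj_maximizer m hS hne hf)] with x hx
  have h1 := hx.2.2.1
  have h2 := le_conj hS hg x hx.2.1
  linarith

theorem dualFunctional_le_of_map_gradient_eq [IsFiniteMeasure μ] [IsFiniteMeasure ν]
    (m : Measure E) [m.IsAddHaarMeasure] (hac : μ ≪ m) (hK : IsCompact K)
    (hμ : ∀ᵐ x ∂μ, x ∈ K) (hS : IsCompact S) (hne : S.Nonempty) (hν : ∀ᵐ p ∂ν, p ∈ S)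
    (hf : ContinuousOn f S) (hg : ContinuousOn g S) (hmap : μ.map (gradient (conj S f)) = ν) :
    dualFunctional μ ν S f ≤ dualFunctional μ ν S g := by
  obtain ⟨hfi, hfe⟩ := dualFunctional_eq_integral hK hμ hS hne hν hf hmap
  obtain ⟨hgi, hge⟩ := dualFunctional_eq_integral hK hμ hS hne hν hg hmap
  rw [hfe, hge]
  exact integral_mono_ae hfi hgi (ae_conj_add_le m hac hS hne hf hg)

/-- Two gradients of conjugates that transport `μ` to `ν` agree almost everywhere: both functions
minimise the dual functional, so Young's inequality for `g` is an equality at `∇f*(x)`, and this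
forces `∇f*(x)` to be the maximizer for `g` too. -/
theorem ae_gradient_conj_eq [IsFiniteMeasure μ] [IsFiniteMeasure ν] (m : Measure E)
    [m.IsAddHaarMeasure] (hac : μ ≪ m) (hK : IsCompact K) (hμ : ∀ᵐ x ∂μ, x ∈ K)
    (hS : IsCompact S) (hne : S.Nonempty) (hν : ∀ᵐ p ∂ν, p ∈ S) (hf : ContinuousOn f S)
    (hg : ContinuousOn g S) (hmapf : μ.map (gradient (conj S f)) = ν)
    (hmapg : μ.map (gradient (conj S g)) = ν) :
    ∀ᵐ x ∂μ, gradient (conj S f) x = gradient (conj S g) x := by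
  have hJ : dualFunctional μ ν S f = dualFunctional μ ν S g := le_antisymm
    (dualFunctional_le_of_map_gradient_eq m hac hK hμ hS hne hν hf hg hmapf)
    (dualFunctional_le_of_map_gradient_eq m hac hK hμ hS hne hν hg hf hmapg)
  obtain ⟨hfi, hfe⟩ := dualFunctional_eq_integral hK hμ hS hne hν hf hmapf
  obtain ⟨hgi, hge⟩ := dualFunctional_eq_integral hK hμ hS hne hν hg hmapf
  have heq := (integral_eq_iff_of_ae_le hfi hgi (ae_conj_add_le m hac hS hne hf hg)).1
    (by rw [← hfe, ← hge, hJ])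
  filter_upwards [heq, hac.ae_le (ae_conj_maximizer m hS hne hf),
    hac.ae_le (ae_conj_maximizer m hS hne hg)] with x hx hxf hxg
  refine hxg.2.2.2 _ hxf.2.1 ?_
  have h1 := hxf.2.2.1
  linarith

end Duality

/-! ### Intensities as measures, and the energy balance as a push-forward -/

section Intensity

variable {n : ℕ} {Ω T : Set (Plane n)} {I L : Plane n → ℝ}

/-- The measure on the plane with density `I` on `Ω` and `0` elsewhere. Negative values of `I`, if
any, count as `0`. -/
noncomputable def intensity (Ω : Set (Plane n)) (I : Plane n → ℝ) : Measure (Plane n) :=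
  (volume.restrict Ω).withDensity fun x => ENNReal.ofReal (I x)

theorem isFiniteMeasure_intensity (hI : IntegrableOn I Ω) : IsFiniteMeasure (intensity Ω I) :=
  isFiniteMeasure_withDensity_ofReal hI.2

theorem intensity_absolutelyContinuous : intensity Ω I ≪ volume :=
  (withDensity_absolutelyContinuous _ _).trans Measure.absolutelyContinuous_restrict

theorem ae_intensity_mem (hΩ : MeasurableSet Ω) : ∀ᵐ x ∂intensity Ω I, x ∈ Ω :=
  (withDensity_absolutelyContinuous _ _).ae_le (ae_restrict_mem hΩ)

theorem intensity_apply (hΩ : MeasurableSet Ω) (hI_nonneg : ∀ x ∈ Ω, 0 ≤ I x)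
    (hI : IntegrableOn I Ω) {A : Set (Plane n)} (hA : MeasurableSet A) :
    intensity Ω I A = ENNReal.ofReal (∫ x in A, Ω.indicator I x) := by
  rw [setIntegral_indicator hΩ, intensity, withDensity_apply _ hA, Measure.restrict_restrict hA,
    ofReal_integral_eq_lintegral_ofReal (hI.mono_set inter_subset_right)]
  filter_upwards [ae_restrict_mem (hA.inter hΩ)] with x hx using hI_nonneg x hx.2

theorem intensity_univ (hΩ : MeasurableSet Ω) (hI_nonneg : ∀ x ∈ Ω, 0 ≤ I x)
    (hI : IntegrableOn I Ω) : intensity Ω I univ = ENNReal.ofReal (∫ x in Ω, I x) := by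
  rw [intensity_apply hΩ hI_nonneg hI .univ, setIntegral_univ, integral_indicator hΩ]

/-- When a multivalued map is almost everywhere given by a single-valued map `G`, the energy balance
on the Borel subsets of `T` says that `G` transports one intensity to the other. Equality of the
total energies covers the sets that leave `T`. -/
theorem energy_iff_map_eq (hΩ : MeasurableSet Ω) (hT : MeasurableSet T)
    (hI_nonneg : ∀ x ∈ Ω, 0 ≤ I x) (hL_nonneg : ∀ p ∈ T, 0 ≤ L p)
    (hI : IntegrableOn I Ω) (hL : IntegrableOn L T) (hEC : ∫ p in T, L p = ∫ x in Ω, I x)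
    {P : Plane n → Set (Plane n)} {G : Plane n → Plane n} (hG : Measurable G)
    (hP : ∀ᵐ x, P x = {G x}) :
    (∀ τ : Set (Plane n), MeasurableSet τ → τ ⊆ T → transported Ω I P τ = ∫ p in τ, L p) ↔
      (intensity Ω I).map G = intensity T L := by
  have hpre : ∀ τ, transported Ω I P τ = ∫ x in G ⁻¹' τ, Ω.indicator I x := fun τ => by
    refine setIntegral_congr_set ?_
    filter_upwards [hP] with x hx
    have : (∃ p ∈ τ, p ∈ P x) ↔ G x ∈ τ := by simp [hx]
    exact propext this
  have hLτ : ∀ τ ⊆ T, ∫ p in τ, L p = ∫ p in τ, T.indicator L p := fun τ hτ => by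
    rw [setIntegral_indicator hT, inter_eq_left.2 hτ]
  have hnn : ∀ (A B : Set (Plane n)) (J : Plane n → ℝ), (∀ x ∈ A, 0 ≤ J x) →
      0 ≤ ∫ x in B, A.indicator J x := fun A B J hJ =>
    integral_nonneg fun x => indicator_nonneg hJ x
  constructor
  · intro h
    have hsub : ∀ τ, MeasurableSet τ → τ ⊆ T → intensity Ω I (G ⁻¹' τ) = intensity T L τ :=
      fun τ hτ hτT => by
        rw [intensity_apply hΩ hI_nonneg hI (hG hτ), intensity_apply hT hL_nonneg hL hτ,
          ← hpre, h τ hτ hτT, hLτ τ hτT]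
    have := isFiniteMeasure_intensity hI
    have hnull : intensity Ω I (G ⁻¹' Tᶜ) = 0 := by
      have h2 := intensity_univ hT hL_nonneg hL
      rw [hEC, ← intensity_univ hΩ hI_nonneg hI] at h2
      rw [preimage_compl, measure_compl (hG hT) (measure_ne_top _ _), hsub T hT subset_rfl, ← h2,
        measure_eq_measure_of_null_sdiff (subset_univ T), tsub_self]
      rw [← compl_eq_univ_sdiff]
      exact ae_intensity_mem hT
    ext τ hτ
    rw [Measure.map_apply hG hτ, ← measure_inter_add_sdiff (G ⁻¹' τ) (hG hT),
      ← measure_inter_add_sdiff τ hT, ← preimage_inter, hsub _ (hτ.inter hT) inter_subset_right]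
    congr 1
    rw [measure_mono_null (fun x hx => hx.2) hnull]
    exact (measure_mono_null (fun x hx => hx.2) (ae_intensity_mem hT)).symm
  · intro h τ hτ hτT
    have h1 := congrArg (fun κ : Measure (Plane n) => κ τ) h
    simp only [Measure.map_apply hG hτ] at h1
    rw [intensity_apply hΩ hI_nonneg hI (hG hτ), intensity_apply hT hL_nonneg hL hτ,
      ENNReal.ofReal_eq_ofReal_iff (hnn _ _ _ hI_nonneg) (hnn _ _ _ hL_nonneg)] at h1
    rw [hpre, h1, hLτ τ hτT]

theorem ae_activeSet_of_ae_intensity (hΩ : MeasurableSet Ω) (hI_nonneg : ∀ x ∈ Ω, 0 ≤ I x)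
    (hI : IntegrableOn I Ω) {q : Plane n → Prop} (h : ∀ᵐ x ∂intensity Ω I, q x) :
    ∀ᵐ x, x ∈ activeSet Ω I → q x := by
  rw [intensity, ae_withDensity_iff' hI.aemeasurable.ennreal_ofReal, ae_restrict_iff' hΩ] at h
  filter_upwards [h] with x hx hact
  have hne : Ω.indicator I x ≠ 0 := hact.2
  have hxΩ : x ∈ Ω := mem_of_indicator_ne_zero hne
  rw [indicator_of_mem hxΩ] at hne
  refine hx hxΩ ?_
  rw [Ne, ENNReal.ofReal_eq_zero, not_le]
  exact lt_of_le_of_ne (hI_nonneg x hxΩ) hne.symm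

end Intensity

/-! ### Suprema under affine changes -/

section Affine

variable {ι : Type*} {s : Set ι} {f g : ι → ℝ} {a b c : ℝ}

theorem isLUB_image_add_mul (h : IsLUB (f '' s) c) (hb : 0 < b)
    (hg : ∀ i ∈ s, g i = a + b * f i) : IsLUB (g '' s) (a + b * c) := by
  constructor
  · rintro _ ⟨i, hi, rfl⟩
    rw [hg i hi]
    have := mul_le_mul_of_nonneg_left (h.1 (mem_image_of_mem f hi)) hb.le
    linarith
  · intro d hd
    have hcd : c ≤ (d - a) / b := h.2 <| by
      rintro _ ⟨i, hi, rfl⟩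
      have := hd (mem_image_of_mem g hi)
      rw [hg i hi] at this
      rw [le_div_iff₀ hb]
      linarith
    rw [le_div_iff₀ hb] at hcd
    linarith

theorem isGLB_image_sub_mul (h : IsLUB (f '' s) c) (hb : 0 < b)
    (hg : ∀ i ∈ s, g i = a - b * f i) : IsGLB (g '' s) (a - b * c) := by
  have h1 := isLUB_image_add_mul (g := fun i => -g i) (a := -a) h hb
    fun i hi => by rw [hg i hi]; ring
  constructor
  · rintro _ ⟨i, hi, rfl⟩
    have := h1.1 (mem_image_of_mem _ hi)
    linarith
  · intro d hd
    have : -a + b * c ≤ -d := h1.2 <| by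
      rintro _ ⟨i, hi, rfl⟩
      exact neg_le_neg (hd (mem_image_of_mem g hi))
    linarith

end Affine

/-! ### Ray-tracing maps and reflectors as conjugates -/

section Reflectors

variable {n : ℕ} {β : ℝ} {Ω T S : Set (Plane n)} {f w : Plane n → ℝ}

theorem ae_normalMap_conj_eq (hS : IsCompact S) (hne : S.Nonempty) (hf : ContinuousOn f S) :
    ∀ᵐ x, normalMap (conj S f) x = {gradient (conj S f) x} := by
  filter_upwards [ae_conj_maximizer volume hS hne hf] with x hx
  refine Subset.antisymm (fun p hp => eq_gradient_of_forall_add_inner_le hx.1 hp) ?_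
  rintro _ rfl
  exact conj_add_inner_le hS hf hx.2.1 hx.2.2.1

/-- Every point of `S` at which `f` equals its biconjugate is a subgradient at some point of `K`. -/
theorem exists_mem_normalMap_conj {K : Set (Plane n)} (hK : IsCompact K) (hKne : K.Nonempty)
    (hS : IsCompact S) (hf : ContinuousOn f S) {p : Plane n} (hp : p ∈ S)
    (h : f p = conj K (conj S f) p) : ∃ x ∈ K, p ∈ normalMap (conj S f) x := by
  obtain ⟨x, hx, he, -⟩ := exists_conj_eq hK hKne
    (continuous_conj hS ⟨p, hp⟩ hf).continuousOn p
  refine ⟨x, hx, conj_add_inner_le hS hf hp ?_⟩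
  rw [real_inner_comm] at he
  linarith

theorem rayMapA_eq (β : ℝ) (T : Set (Plane n)) (w : Plane n → ℝ) :
    rayMapA β T w = normalMap (conj (closure T) fun p => ‖p‖ ^ 2 / 2 - β * w p) := by
  have : potentialA β T w = conj (closure T) fun p => ‖p‖ ^ 2 / 2 - β * w p := by
    funext x
    unfold potentialA conj
    congr 1
    refine image_congr fun p _ => ?_
    rw [Q]
    ring
  funext x
  rw [rayMapA, this]


/-- The potential of type B is minus a conjugate relative to the reflected set `-T̄`. -/
theorem neg_potentialB_eq (β : ℝ) (T : Set (Plane n)) (w : Plane n → ℝ) (x : Plane n) :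
    -potentialB β T w x =
      conj (Neg.neg '' closure T) (fun p => β * w (-p) - ‖p‖ ^ 2 / 2) x := by
  unfold potentialB conj
  rw [Real.sInf_def, neg_neg, image_image, ← image_neg_eq_neg, image_image]
  congr 1
  refine image_congr fun p _ => ?_
  simp only [Q, inner_neg_right, norm_neg, neg_neg]
  ring

theorem rayMapB_eq (β : ℝ) (T : Set (Plane n)) (w : Plane n → ℝ) (x : Plane n) :
    rayMapB β T w x = {p | -p ∈ normalMap
      (conj (Neg.neg '' closure T) fun p => β * w (-p) - ‖p‖ ^ 2 / 2) x} := by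
  have : (fun y => -potentialB β T w y) =
      conj (Neg.neg '' closure T) fun p => β * w (-p) - ‖p‖ ^ 2 / 2 :=
    funext (neg_potentialB_eq β T w)
  rw [rayMapB, this]

theorem continuousOn_neg_image {S : Set (Plane n)} (hw : ContinuousOn w S) :
    ContinuousOn (fun p => β * w (-p) - ‖p‖ ^ 2 / 2) (Neg.neg '' S) := by
  have h : ContinuousOn (fun p => w (-p)) (Neg.neg '' S) := by
    refine hw.comp continuous_neg.continuousOn ?_
    rintro _ ⟨p, hp, rfl⟩
    simpa using hp
  exact (continuousOn_const.mul h).sub (by fun_prop)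

/-- A function equal to its biconjugate gives a two-reflector of type A: completing squares in the
two families of paraboloids turns the reflector equations into conjugacy relations. -/
theorem isTwoReflectorA_of_conj (hβ : 0 < β) (hK : IsCompact (closure Ω))
    (hKne : (closure Ω).Nonempty) (hS : IsCompact (closure T)) (hne : (closure T).Nonempty)
    (hf : Continuous f) (hff : ∀ p ∈ closure T, f p = conj (closure Ω) (conj (closure T) f) p) :
    IsTwoReflectorA β Ω T (fun x => (β / 2 - ‖x‖ ^ 2 / (2 * β)) + β⁻¹ * conj (closure T) f x)
      (fun p => ‖p‖ ^ 2 / (2 * β) - β⁻¹ * f p) := by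
  have hu := continuous_conj hS hne hf.continuousOn
  refine ⟨by fun_prop, by fun_prop, fun x _ => ?_, fun p hp => ?_⟩
  · refine isLUB_image_add_mul (isLUB_conj hS hne hf.continuousOn x) (inv_pos.2 hβ)
      fun p _ => ?_
    rw [kParab, norm_sub_sq_real]
    field_simp
    ring
  · rw [hff p hp]
    refine isGLB_image_sub_mul (isLUB_conj hK hKne hu.continuousOn p) (inv_pos.2 hβ)
      fun x _ => ?_
    rw [hParab, norm_sub_sq_real, real_inner_comm x p]
    field_simp
    ring

theorem isTwoReflectorB_of_conj (hβ : 0 < β) (hK : IsCompact (closure Ω))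
    (hKne : (closure Ω).Nonempty) (hS : IsCompact (closure T)) (hne : (closure T).Nonempty)
    (hf : Continuous f)
    (hff : ∀ p ∈ Neg.neg '' closure T,
      f p = conj (closure Ω) (conj (Neg.neg '' closure T) f) p) :
    IsTwoReflectorB β Ω T
      (fun x => (β / 2 - ‖x‖ ^ 2 / (2 * β)) - β⁻¹ * conj (Neg.neg '' closure T) f x)
      (fun p => ‖p‖ ^ 2 / (2 * β) + β⁻¹ * f (-p)) := by
  have hS' : IsCompact (Neg.neg '' closure T) := hS.image continuous_neg
  have hu := continuous_conj hS' (hne.image _) hf.continuousOn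
  refine ⟨by fun_prop, by fun_prop, fun x _ => ?_, fun p hp => ?_⟩
  · have h := isLUB_conj hS' (hne.image _) hf.continuousOn x
    rw [image_image] at h
    refine isGLB_image_sub_mul h (inv_pos.2 hβ) fun p _ => ?_
    rw [kParab, norm_sub_sq_real, inner_neg_right]
    field_simp
    ring
  · rw [hff _ (mem_image_of_mem _ hp)]
    refine isLUB_image_add_mul (isLUB_conj hK hKne hu.continuousOn (-p)) (inv_pos.2 hβ)
      fun x _ => ?_
    rw [hParab, norm_sub_sq_real, inner_neg_left, real_inner_comm x p]
    field_simp
    ring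

theorem ae_rayMapA_eq (hS : IsCompact (closure T)) (hne : (closure T).Nonempty)
    (hw : ContinuousOn w (closure T)) :
    ∀ᵐ x, rayMapA β T w x =
      {gradient (conj (closure T) fun p => ‖p‖ ^ 2 / 2 - β * w p) x} := by
  rw [rayMapA_eq]
  exact ae_normalMap_conj_eq hS hne (by fun_prop)

theorem ae_rayMapB_eq (hS : IsCompact (closure T)) (hne : (closure T).Nonempty)
    (hw : ContinuousOn w (closure T)) :
    ∀ᵐ x, rayMapB β T w x = {-gradient
      (conj (Neg.neg '' closure T) fun p => β * w (-p) - ‖p‖ ^ 2 / 2) x} := by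
  filter_upwards [ae_normalMap_conj_eq (hS.image continuous_neg) (hne.image _)
    (continuousOn_neg_image hw)] with x hx
  rw [rayMapB_eq, hx]
  ext p
  simp [neg_eq_iff_eq_neg]

theorem map_neg_gradient_eq_iff {μ ν : Measure (Plane n)} (u : Plane n → ℝ) :
    μ.map (fun x => -gradient u x) = ν ↔ μ.map (gradient u) = ν.map Neg.neg := by
  have h : μ.map (fun x => -gradient u x) = (μ.map (gradient u)).map Neg.neg :=
    (Measure.map_map measurable_neg (measurable_gradient u)).symm
  have hinv : ∀ κ : Measure (Plane n), (κ.map Neg.neg).map Neg.neg = κ := fun κ => by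
    rw [Measure.map_map measurable_neg measurable_neg]
    simp
  rw [h]
  constructor
  · rintro rfl
    rw [hinv]
  · intro h
    rw [h, hinv]

end Reflectors

/-! ### Existence and uniqueness of weak solutions -/

section Solutions

variable {n : ℕ} {β : ℝ} {Ω T : Set (Plane n)} {I L : Plane n → ℝ}

theorem IsBoundedDomain.isCompact_closure (hΩ : IsBoundedDomain Ω) : IsCompact (closure Ω) :=
  hΩ.2.2.isCompact_closure

theorem IsBoundedDomain.nonempty_closure (hΩ : IsBoundedDomain Ω) : (closure Ω).Nonempty :=
  hΩ.2.1.nonempty.closure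

theorem IsBoundedDomain.ae_intensity_mem_closure (hΩ : IsBoundedDomain Ω) :
    ∀ᵐ x ∂intensity Ω I, x ∈ closure Ω :=
  (ae_intensity_mem hΩ.1.measurableSet).mono fun _ hx => subset_closure hx

theorem ae_map_neg_mem {ν : Measure (Plane n)} {S : Set (Plane n)} (hS : IsCompact S)
    (hν : ∀ᵐ p ∂ν, p ∈ S) : ∀ᵐ p ∂ν.map Neg.neg, p ∈ Neg.neg '' S := by
  refine (ae_map_iff measurable_neg.aemeasurable (hS.image continuous_neg).measurableSet).2 ?_
  exact hν.mono fun p hp => mem_image_of_mem _ hp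

theorem exists_isWeakSolutionA (hβ : 0 < β) (hΩ : IsBoundedDomain Ω) (hT : IsBoundedDomain T)
    (hI_nonneg : ∀ x ∈ Ω, 0 ≤ I x) (hL_nonneg : ∀ p ∈ T, 0 ≤ L p)
    (hI : IntegrableOn I Ω) (hL : IntegrableOn L T)
    (hEC : ∫ p in T, L p = ∫ x in Ω, I x) :
    ∃ z w : Plane n → ℝ, IsWeakSolutionA β Ω T I L z w := by
  have hK := hΩ.isCompact_closure
  have hS := hT.isCompact_closure
  have hne := hT.nonempty_closure
  have := isFiniteMeasure_intensity hI
  have := isFiniteMeasure_intensity hL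
  have hM : intensity Ω I univ = intensity T L univ := by
    rw [intensity_univ hΩ.1.measurableSet hI_nonneg hI,
      intensity_univ hT.1.measurableSet hL_nonneg hL, hEC]
  obtain ⟨f, hf, hff, hmin⟩ := exists_isMinOn_dualFunctional hK hΩ.nonempty_closure
    hΩ.ae_intensity_mem_closure hS hne hT.ae_intensity_mem_closure hM
  have hmap := map_gradient_eq_of_isMin volume intensity_absolutelyContinuous hK
    hΩ.ae_intensity_mem_closure hS hne hT.ae_intensity_mem_closure hf.continuousOn hmin
  have hrefl := isTwoReflectorA_of_conj hβ hK hΩ.nonempty_closure hS hne hf hff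
  have hw : (fun p : Plane n => ‖p‖ ^ 2 / 2 - β * (‖p‖ ^ 2 / (2 * β) - β⁻¹ * f p)) = f := by
    funext p
    field_simp
    ring
  refine ⟨_, _, hrefl, fun p hp => ?_, ?_⟩
  · rw [rayMapA_eq, hw]
    exact exists_mem_normalMap_conj hK hΩ.nonempty_closure hS hf.continuousOn hp (hff p hp)
  · rw [energy_iff_map_eq hΩ.1.measurableSet hT.1.measurableSet hI_nonneg hL_nonneg hI hL hEC
      (measurable_gradient _) (ae_rayMapA_eq hS hne hrefl.cont_w), hw]
    exact hmap

theorem exists_isWeakSolutionB (hβ : 0 < β) (hΩ : IsBoundedDomain Ω) (hT : IsBoundedDomain T)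
    (hI_nonneg : ∀ x ∈ Ω, 0 ≤ I x) (hL_nonneg : ∀ p ∈ T, 0 ≤ L p)
    (hI : IntegrableOn I Ω) (hL : IntegrableOn L T)
    (hEC : ∫ p in T, L p = ∫ x in Ω, I x) :
    ∃ z w : Plane n → ℝ, IsWeakSolutionB β Ω T I L z w := by
  have hK := hΩ.isCompact_closure
  have hS := hT.isCompact_closure
  have hne := hT.nonempty_closure
  have hS' : IsCompact (Neg.neg '' closure T) := hS.image continuous_neg
  have := isFiniteMeasure_intensity hI
  have := isFiniteMeasure_intensity hL
  have hν := ae_map_neg_mem hS (hT.ae_intensity_mem_closure (I := L))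
  have hM : intensity Ω I univ = (intensity T L).map Neg.neg univ := by
    rw [Measure.map_apply measurable_neg .univ, preimage_univ,
      intensity_univ hΩ.1.measurableSet hI_nonneg hI,
      intensity_univ hT.1.measurableSet hL_nonneg hL, hEC]
  obtain ⟨f, hf, hff, hmin⟩ := exists_isMinOn_dualFunctional hK hΩ.nonempty_closure
    hΩ.ae_intensity_mem_closure hS' (hne.image _) hν hM
  have hmap := map_gradient_eq_of_isMin volume intensity_absolutelyContinuous hK
    hΩ.ae_intensity_mem_closure hS' (hne.image _) hν hf.continuousOn hmin
  have hrefl := isTwoReflectorB_of_conj hβ hK hΩ.nonempty_closure hS hne hf hff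
  have hw : (fun p : Plane n =>
      β * (‖-p‖ ^ 2 / (2 * β) + β⁻¹ * f (- -p)) - ‖p‖ ^ 2 / 2) = f := by
    funext p
    rw [norm_neg, neg_neg]
    field_simp
    ring
  refine ⟨_, _, hrefl, fun p hp => ?_, ?_⟩
  · simp only [rayMapB_eq, hw]
    have hp' := mem_image_of_mem Neg.neg hp
    exact exists_mem_normalMap_conj hK hΩ.nonempty_closure hS' hf.continuousOn hp' (hff _ hp')
  · rw [energy_iff_map_eq hΩ.1.measurableSet hT.1.measurableSet hI_nonneg hL_nonneg hI hL hEC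
      (measurable_gradient _).neg (ae_rayMapB_eq hS hne hrefl.cont_w), hw]
    exact (map_neg_gradient_eq_iff _).2 hmap

theorem IsWeakSolutionA.ae_rayMapA_eq_rayMapA (hΩ : IsBoundedDomain Ω) (hT : IsBoundedDomain T)
    (hI_nonneg : ∀ x ∈ Ω, 0 ≤ I x) (hL_nonneg : ∀ p ∈ T, 0 ≤ L p)
    (hI : IntegrableOn I Ω) (hL : IntegrableOn L T)
    (hEC : ∫ p in T, L p = ∫ x in Ω, I x) {z w z' w' : Plane n → ℝ}
    (h : IsWeakSolutionA β Ω T I L z w) (h' : IsWeakSolutionA β Ω T I L z' w') :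
    ∀ᵐ x, x ∈ activeSet Ω I → rayMapA β T w x = rayMapA β T w' x := by
  have hS := hT.isCompact_closure
  have hne := hT.nonempty_closure
  have := isFiniteMeasure_intensity hI
  have := isFiniteMeasure_intensity hL
  have hw := h.1.cont_w
  have hw' := h'.1.cont_w
  have hmap := (energy_iff_map_eq hΩ.1.measurableSet hT.1.measurableSet hI_nonneg hL_nonneg hI hL
    hEC (measurable_gradient _) (ae_rayMapA_eq hS hne hw)).1 h.2.energy
  have hmap' := (energy_iff_map_eq hΩ.1.measurableSet hT.1.measurableSet hI_nonneg hL_nonneg hI hL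
    hEC (measurable_gradient _) (ae_rayMapA_eq hS hne hw')).1 h'.2.energy
  have heq := ae_gradient_conj_eq volume intensity_absolutelyContinuous hΩ.isCompact_closure
    hΩ.ae_intensity_mem_closure hS hne hT.ae_intensity_mem_closure (by fun_prop) (by fun_prop)
    hmap hmap'
  filter_upwards [ae_activeSet_of_ae_intensity hΩ.1.measurableSet hI_nonneg hI heq,
    ae_rayMapA_eq (β := β) hS hne hw, ae_rayMapA_eq (β := β) hS hne hw'] with x hx h1 h2 hact
  rw [h1, h2, hx hact]

theorem IsWeakSolutionB.ae_rayMapB_eq_rayMapB (hΩ : IsBoundedDomain Ω) (hT : IsBoundedDomain T)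
    (hI_nonneg : ∀ x ∈ Ω, 0 ≤ I x) (hL_nonneg : ∀ p ∈ T, 0 ≤ L p)
    (hI : IntegrableOn I Ω) (hL : IntegrableOn L T)
    (hEC : ∫ p in T, L p = ∫ x in Ω, I x) {z w z' w' : Plane n → ℝ}
    (h : IsWeakSolutionB β Ω T I L z w) (h' : IsWeakSolutionB β Ω T I L z' w') :
    ∀ᵐ x, x ∈ activeSet Ω I → rayMapB β T w x = rayMapB β T w' x := by
  have hS := hT.isCompact_closure
  have hne := hT.nonempty_closure
  have := isFiniteMeasure_intensity hI
  have := isFiniteMeasure_intensity hL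
  have hw := h.1.cont_w
  have hw' := h'.1.cont_w
  have hmap := (energy_iff_map_eq hΩ.1.measurableSet hT.1.measurableSet hI_nonneg hL_nonneg hI hL
    hEC (measurable_gradient _).neg (ae_rayMapB_eq hS hne hw)).1 h.2.energy
  have hmap' := (energy_iff_map_eq hΩ.1.measurableSet hT.1.measurableSet hI_nonneg hL_nonneg hI hL
    hEC (measurable_gradient _).neg (ae_rayMapB_eq hS hne hw')).1 h'.2.energy
  have heq := ae_gradient_conj_eq volume intensity_absolutelyContinuous hΩ.isCompact_closure
    hΩ.ae_intensity_mem_closure (hS.image continuous_neg) (hne.image _)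
    (ae_map_neg_mem hS (hT.ae_intensity_mem_closure (I := L)))
    (continuousOn_neg_image hw) (continuousOn_neg_image hw')
    ((map_neg_gradient_eq_iff _).1 hmap) ((map_neg_gradient_eq_iff _).1 hmap')
  filter_upwards [ae_activeSet_of_ae_intensity hΩ.1.measurableSet hI_nonneg hI heq,
    ae_rayMapB_eq (β := β) hS hne hw, ae_rayMapB_eq (β := β) hS hne hw'] with x hx h1 h2 hact
  rw [h1, h2, hx hact]

end Solutions

end TwoReflector

theorem mainTheorem1 (n : ℕ) (hn : 2 ≤ n) (β : ℝ) (hβ : 0 < β)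
    (Ω T : Set (TwoReflector.Plane n))
    (hΩ : TwoReflector.IsBoundedDomain Ω) (hT : TwoReflector.IsBoundedDomain T)
    (I L : TwoReflector.Plane n → ℝ)
    (hI_nonneg : ∀ x ∈ Ω, 0 ≤ I x) (hL_nonneg : ∀ p ∈ T, 0 ≤ L p)
    (hI : MeasureTheory.IntegrableOn I Ω) (hL : MeasureTheory.IntegrableOn L T)
    (hEC : ∫ p in T, L p = ∫ x in Ω, I x) :
    (∃ z w : TwoReflector.Plane n → ℝ, TwoReflector.IsWeakSolutionA β Ω T I L z w) ∧
    (∃ z w : TwoReflector.Plane n → ℝ, TwoReflector.IsWeakSolutionB β Ω T I L z w) ∧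
    (∀ z w z' w' : TwoReflector.Plane n → ℝ,
      TwoReflector.IsWeakSolutionA β Ω T I L z w →
      TwoReflector.IsWeakSolutionA β Ω T I L z' w' →
      ∀ᵐ x, x ∈ TwoReflector.activeSet Ω I →
        TwoReflector.rayMapA β T w x = TwoReflector.rayMapA β T w' x) ∧
    (∀ z w z' w' : TwoReflector.Plane n → ℝ,
      TwoReflector.IsWeakSolutionB β Ω T I L z w →
      TwoReflector.IsWeakSolutionB β Ω T I L z' w' →
      ∀ᵐ x, x ∈ TwoReflector.activeSet Ω I →
        TwoReflector.rayMapB β T w x = TwoReflector.rayMapB β T w' x) := by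
  open TwoReflector in
  exact ⟨exists_isWeakSolutionA hβ hΩ hT hI_nonneg hL_nonneg hI hL hEC,
    exists_isWeakSolutionB hβ hΩ hT hI_nonneg hL_nonneg hI hL hEC,
    fun _ _ _ _ h h' =>
      h.ae_rayMapA_eq_rayMapA hΩ hT hI_nonneg hL_nonneg hI hL hEC h',
    fun _ _ _ _ h h' =>
      h.ae_rayMapB_eq_rayMapB hΩ hT hI_nonneg hL_nonneg hI hL hEC h'⟩
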